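/- For $a>0$ consider the Lanford system $\dot p=\varphi(p)$ on $\mathbb{R}^3$, $p=(x,y,z)$, where $$\varphi(x,y,z)=\bigl((a-1)x-y+xz,\; x+(a-1)y+yz,\; az-(x^2+y^2+z^2)\bigr),$$ and its equilibrium $O_2=(0,0,a)$. A set $K\subset\mathbb{R}^3$ is called forward-invariant if every point of $K$ is the initial state of a solution defined for all $t\ge 0$ and every solution that starts in $K$ stays in $K$; let $\varphi^\tau$ denote the time-$\tau$ map on such a $K$. For $\tau\ge 0$, $q\in K$ and $\delta>0$ let $N(\tau,q,\delta)$ be the minimal number of open Euclidean balls of radius $\delta$ needed to cover $\varphi^\tau[B_\delta(q)\cap K]$, where $B_\delta(q)$ is the open ball of radius $\delta$ centered at $q$. The restoration entropy of the system on $K$ is $$H_{\mathrm{res}}(\varphi,K)=\lim_{\tau\to\infty}\frac1\tau\,\limsup_{\delta\to0+}\,\sup_{q\in K}\log_2 N(\tau,q,\delta).$$ **Theorem.** Let $a\ge 2/3$, and let $K\subset\mathbb{R}^3$ be a compact forward-invariant set of the Lanford system that is the closure of its interior and contains $O_2$ (in particular, any such $K$ that contains $O_2$ in its interior). Then the limit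 defining $H_{\mathrm{res}}(\varphi,K)$ exists and $$H_{\mathrm{res}}(\varphi,K)=\frac{2(2a-1)}{\ln 2}.$$ -/

import Mathlib

open Set Filter Topology

/-- `flowImage φ τ S` is the image `φ^τ[S]` of `S` under the time-`τ` map of `ẋ = φ(x)`: all the
values `x(τ)` of solutions `x : [0, τ] → ℝⁿ` of the equation with `x(0) ∈ S`. -/
def flowImage {n : ℕ} (φ : EuclideanSpace ℝ (Fin n) → EuclideanSpace ℝ (Fin n)) (τ : ℝ)
    (S : Set (EuclideanSpace ℝ (Fin n))) : Set (EuclideanSpace ℝ (Fin n)) :=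
  {y | ∃ γ : ℝ → EuclideanSpace ℝ (Fin n),
    IsIntegralCurveOn γ (fun _ => φ) (Icc 0 τ) ∧ γ 0 ∈ S ∧ γ τ = y}

/-- Forward invariance of `K` for `ẋ = φ(x)`: every point of `K` starts a solution that is defined
for all `t ≥ 0`, and every solution that starts in `K` stays in `K`. -/
def IsForwardInvariantSet {n : ℕ} (φ : EuclideanSpace ℝ (Fin n) → EuclideanSpace ℝ (Fin n))
    (K : Set (EuclideanSpace ℝ (Fin n))) : Prop :=
  (∀ x ∈ K, ∃ γ : ℝ → EuclideanSpace ℝ (Fin n),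
    γ 0 = x ∧ IsIntegralCurveOn γ (fun _ => φ) (Ici 0)) ∧
  ∀ τ : ℝ, 0 ≤ τ → flowImage φ τ K ⊆ K

/-- The minimal number of open Euclidean balls of radius `δ` (with arbitrary centres in `ℝⁿ`)
that cover `S`. -/
noncomputable def ballCoveringNumber {n : ℕ} (δ : ℝ) (S : Set (EuclideanSpace ℝ (Fin n))) : ℕ∞ :=
  ⨅ (F : Finset (EuclideanSpace ℝ (Fin n))) (_ : S ⊆ ⋃ c ∈ F, Metric.ball c δ), (F.card : ℕ∞)

/-- The base-2 logarithm with values in the extended reals. -/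
noncomputable def extLog2 (N : ℕ∞) : EReal :=
  ENNReal.log (N : ENNReal) / ((Real.log 2 : ℝ) : EReal)

/-- `limsup_{δ → 0+} sup_{x ∈ K} log₂ N(τ, x, δ)`, where `N(τ, x, δ)` is the minimal number of open
`δ`-balls needed to cover `φ^τ[B_δ(x) ∩ K]`. -/
noncomputable def restorationRate {n : ℕ}
    (φ : EuclideanSpace ℝ (Fin n) → EuclideanSpace ℝ (Fin n))
    (K : Set (EuclideanSpace ℝ (Fin n))) (τ : ℝ) : EReal :=
  limsup (fun δ : ℝ =>
    ⨆ x ∈ K, extLog2 (ballCoveringNumber δ (flowImage φ τ (Metric.ball x δ ∩ K)))) (𝓝[>] 0)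

/-- The restoration entropy `H_res(φ, K) = lim_{τ → ∞} τ⁻¹ limsup_{δ → 0} sup_{x ∈ K} log₂ N(τ, x, δ)`
of `ẋ = φ(x)` on `K` exists and equals `h`. (Limits in `EReal` along `atTop` are unique.) -/
def HasRestorationEntropy {n : ℕ} (φ : EuclideanSpace ℝ (Fin n) → EuclideanSpace ℝ (Fin n))
    (K : Set (EuclideanSpace ℝ (Fin n))) (h : EReal) : Prop :=
  Tendsto (fun τ : ℝ => restorationRate φ K τ / (τ : EReal)) atTop (𝓝 h)

/-- The right-hand side of the Lanford system with parameter `a`. -/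
noncomputable def lanfordField (a : ℝ) (p : EuclideanSpace ℝ (Fin 3)) :
    EuclideanSpace ℝ (Fin 3) :=
  !₂[(a - 1) * p 0 - p 1 + p 0 * p 2,
     p 0 + (a - 1) * p 1 + p 1 * p 2,
     a * p 2 - (p 0 ^ 2 + p 1 ^ 2 + p 2 ^ 2)]

/-- The equilibrium `O₂ = (0, 0, a)` of the Lanford system. -/
noncomputable def lanfordO2 (a : ℝ) : EuclideanSpace ℝ (Fin 3) := !₂[0, 0, a]

/-!
The number `2 (2 a - 1)` is the sum of the positive exponents of the linearization at the
equilibrium `O₂ = (0, 0, a)`, whose eigenvalues have real parts `2 a - 1`, `2 a - 1`, `-a`; the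
division by `log 2` turns it into bits.

*Upper bound.* The Jacobian of the field becomes, in the metric `dx² + dy² + dz² / 2`, the sum of a
skew-symmetric matrix and `diag (h, h, v)` with `h = a - 1 + z`, `v = a - 2 z`. On a compact
forward-invariant set `z ≥ 0`, and along orbits `z ≤ a + O(exp (-a t))` (`lanford_z_nonneg`,
`lanford_z_le`). So the sum of the positive ones among `h, h, v` is at most
`2 (2 a - 1) + O(exp (-a t))`; the condition `a ≥ 2/3` is what makes `v ≤ a` harmless. To turn this
into a bound for covering numbers without singular values, let `M` be the fundamental matrix of
the linearization along an orbit and follow `det (W + M Mᵀ)` with `W = diag (1, 1, 2)`: its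
logarithmic derivative is at most twice the sum above (`lanford_det_le`), and its square root
bounds, up to a constant factor, the number of `δ`-balls needed for a `δ/2`-thickening of the
`M`-image of a `δ`-ball, by comparing volumes (`exists_finset_cover_of_linear_image_add`). The field
is quadratic, so the error of the linearization is explicit and is `O(δ²)` uniformly on the set
(`lanford_linearization_error`).

*Lower bound.* Near `O₂` the flow expands horizontal differences at a rate close to `2 a - 1`
(`lanford_expansion`). A horizontal grid in a small ball around an interior point close to `O₂`
therefore becomes `2 δ`-separated, and each point of its image needs a ball of its own
(`exists_lanford_separated`).

Both bounds hold for each `τ` up to a factor that does not depend on `τ`, and the limit follows.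
-/

/-! ### Grönwall's inequality and linear differential equations -/

/-- Grönwall's inequality for a real function with a variable rate: `y' ≤ g' y` gives
`y(t) ≤ y(0) exp (g(t) - g(0))`. No sign of `y` is needed, so the lemma also yields lower bounds
when applied to `-y`. -/
theorem le_mul_exp_of_hasDerivWithinAt_le {y y' g g' : ℝ → ℝ} {T : ℝ}
    (hy : ∀ t ∈ Icc 0 T, HasDerivWithinAt y (y' t) (Icc 0 T) t)
    (hg : ∀ t ∈ Icc 0 T, HasDerivWithinAt g (g' t) (Icc 0 T) t)
    (h : ∀ t ∈ Icc 0 T, y' t ≤ g' t * y t) {t : ℝ} (ht : t ∈ Icc 0 T) :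
    y t ≤ y 0 * Real.exp (g t - g 0) := by
  have hd : ∀ s ∈ Icc 0 T, HasDerivWithinAt (fun s => y s * Real.exp (-g s))
      (y' s * Real.exp (-g s) + y s * (Real.exp (-g s) * -g' s)) (Icc 0 T) s :=
    fun s hs => (hy s hs).mul (hg s hs).neg.exp
  have hanti : AntitoneOn (fun s => y s * Real.exp (-g s)) (Icc 0 T) := by
    refine antitoneOn_of_hasDerivWithinAt_nonpos (convex_Icc 0 T)
      (fun s hs => (hd s hs).continuousWithinAt)
      (fun s hs => (hd s (interior_subset hs)).mono interior_subset) (fun s hs => ?_)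
    have h1 := h s (interior_subset hs)
    have h2 := Real.exp_pos (-g s)
    nlinarith
  have h0 := hanti (left_mem_Icc.2 (ht.1.trans ht.2)) ht ht.1
  have h3 : y t = y t * Real.exp (-g t) * Real.exp (g t) := by
    rw [mul_assoc, ← Real.exp_add]; simp
  rw [h3, show g t - g 0 = -g 0 + g t by ring, Real.exp_add, ← mul_assoc]
  exact mul_le_mul_of_nonneg_right h0 (Real.exp_pos _).le

/-- A linear differential equation with continuous coefficients has a solution on the whole
interval on which the coefficients are given. -/
theorem exists_forall_hasDerivWithinAt_linear {ι : Type*} [Fintype ι] {T : ℝ} (hT : 0 ≤ T)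
    {A : ℝ → (ι → ℝ) →L[ℝ] (ι → ℝ)} (hA : ContinuousOn A (Icc 0 T)) (x₀ : ι → ℝ) :
    ∃ α : ℝ → ι → ℝ, α 0 = x₀ ∧
      ∀ t ∈ Icc 0 T, HasDerivWithinAt α (A t (α t)) (Icc 0 T) t := by
  obtain ⟨L, hL⟩ := isCompact_Icc.exists_bound_of_continuousOn hA
  have hL0 : 0 ≤ L := (norm_nonneg _).trans (hL 0 (left_mem_Icc.2 hT))
  set R : ℝ := ‖x₀‖ * Real.exp (L * T) with hR
  have hR0 : 0 ≤ R := by positivity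
  -- The field is cut off outside the cube of radius `R`, which makes it bounded; the cut-off
  -- solution never leaves the cube.
  let cl : (ι → ℝ) → ι → ℝ := fun x i => max (-R) (min R (x i))
  have hcl_lip : LipschitzWith 1 cl := by
    refine LipschitzWith.of_dist_le_mul fun x y => ?_
    rw [NNReal.coe_one, one_mul]
    refine (dist_pi_le_iff dist_nonneg).2 fun i => ?_
    refine le_trans ?_ (dist_le_pi_dist x y i)
    have : LipschitzWith 1 (fun s : ℝ => max (-R) (min R s)) :=
      (LipschitzWith.id.const_min R).const_max (-R)
    simpa using this.dist_le_mul (x i) (y i)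
  have hcl_bd : ∀ x, ‖cl x‖ ≤ R := fun x => by
    refine (pi_norm_le_iff_of_nonneg hR0).2 fun i => ?_
    rw [Real.norm_eq_abs, abs_le]
    exact ⟨le_max_left _ _, max_le (by linarith) (min_le_left _ _)⟩
  have hcl_zero : cl 0 = 0 := by
    ext i; simp [cl, hR0]
  have hcl_le : ∀ x, ‖cl x‖ ≤ ‖x‖ := fun x => by
    have := hcl_lip.dist_le_mul x 0
    rwa [hcl_zero, dist_zero_right, dist_zero_right, NNReal.coe_one, one_mul] at this
  have hcl_eq : ∀ x, ‖x‖ ≤ R → cl x = x := fun x hx => by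
    ext i
    have := (norm_le_pi_norm x i).trans hx
    rw [Real.norm_eq_abs, abs_le] at this
    simp [cl, this.1, this.2]
  have hPL : IsPicardLindelof (fun t x => A t (cl x)) (tmin := 0) (tmax := T)
      ⟨0, left_mem_Icc.2 hT⟩ x₀ (L * R * T).toNNReal 0 (L * R).toNNReal L.toNNReal := by
    refine ⟨fun t ht => ?_, fun x _ => ?_, fun t ht x _ => ?_, ?_⟩
    · refine (LipschitzWith.of_dist_le_mul fun x y => ?_).lipschitzOnWith
      rw [dist_eq_norm, ← map_sub, Real.coe_toNNReal L hL0]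
      refine ((A t).le_opNorm _).trans ?_
      refine mul_le_mul (hL t ht) ?_ (norm_nonneg _) hL0
      rw [← dist_eq_norm]
      simpa using hcl_lip.dist_le_mul x y
    · exact hA.clm_apply continuousOn_const
    · rw [Real.coe_toNNReal _ (by positivity)]
      exact ((A t).le_opNorm _).trans
        (mul_le_mul (hL t ht) (hcl_bd x) (norm_nonneg _) hL0)
    · simp only [sub_zero, sub_self, max_eq_left hT, NNReal.coe_zero]
      rw [Real.coe_toNNReal _ (by positivity), Real.coe_toNNReal _ (by positivity)]
  obtain ⟨α, h0, hα⟩ := hPL.exists_eq_forall_mem_Icc_hasDerivWithinAt₀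
  refine ⟨α, h0, fun t ht => ?_⟩
  have hbd : ‖α t‖ ≤ R := by
    have h1 : ‖α t‖ ≤ gronwallBound ‖x₀‖ L 0 (t - 0) := by
      refine norm_le_gronwallBound_of_norm_deriv_right_le
        (f' := fun t => A t (cl (α t))) (fun s hs => (hα s hs).continuousWithinAt) ?_ ?_ ?_ t ht
      · exact fun s hs => (hα s (Ico_subset_Icc_self hs)).mono_of_mem_nhdsWithin
          (Icc_mem_nhdsGE_of_mem hs)
      · exact le_of_eq (congrArg norm h0)
      · intro s hs
        rw [add_zero]
        exact ((A s).le_opNorm _).trans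
          (mul_le_mul (hL s (Ico_subset_Icc_self hs)) (hcl_le _) (norm_nonneg _) hL0)
    rw [gronwallBound_ε0, sub_zero] at h1
    refine h1.trans ?_
    rw [hR]
    gcongr
    exact ht.2
  have := hα t ht
  simpa only [hcl_eq _ hbd] using this

/-! ### Covering numbers -/

/-- A maximal `δ`-separated subset is the set of centres of a cover by open `δ`-balls, so a bound on
the size of `δ`-separated subsets is a bound on the size of some cover. -/
theorem exists_finset_cover_of_card_separated_le {X : Type*} [PseudoMetricSpace X] {S : Set X}
    {δ B : ℝ} (hδ : 0 < δ)
    (h : ∀ F : Finset X, (F : Set X) ⊆ S → (F : Set X).Pairwise (fun x y => δ ≤ dist x y) →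
      (F.card : ℝ) ≤ B) :
    ∃ F : Finset X, S ⊆ ⋃ c ∈ F, Metric.ball c δ ∧ (F.card : ℝ) ≤ B := by
  classical
  by_contra! hcon
  have key : ∀ n : ℕ, ∃ F : Finset X, F.card = n ∧ (F : Set X) ⊆ S ∧
      (F : Set X).Pairwise (fun x y => δ ≤ dist x y) := by
    intro n
    induction n with
    | zero => exact ⟨∅, by simp⟩
    | succ n ih =>
      obtain ⟨F, hF, hFS, hsep⟩ := ih
      by_cases hc : S ⊆ ⋃ c ∈ F, Metric.ball c δ
      · exact absurd (h F hFS hsep) (not_le.2 (hcon F hc))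
      obtain ⟨x, hxS, hx⟩ := not_subset.1 hc
      simp only [mem_iUnion, Metric.mem_ball, not_exists, not_lt] at hx
      have hxF : x ∉ F := fun hxF => by
        have := hx x hxF
        rw [dist_self] at this
        linarith
      refine ⟨insert x F, by rw [Finset.card_insert_of_notMem hxF, hF], ?_, ?_⟩
      · rw [Finset.coe_insert]; exact insert_subset hxS hFS
      · rw [Finset.coe_insert]
        refine hsep.insert fun y hy _ => ⟨hx y hy, ?_⟩
        rw [dist_comm]; exact hx y hy
  obtain ⟨n, hn⟩ := exists_nat_gt B
  obtain ⟨F, hF, hFS, hsep⟩ := key n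
  have := h F hFS hsep
  rw [hF] at this
  linarith

theorem ballCoveringNumber_le {n : ℕ} {δ : ℝ} {S : Set (EuclideanSpace ℝ (Fin n))}
    {F : Finset (EuclideanSpace ℝ (Fin n))} (h : S ⊆ ⋃ c ∈ F, Metric.ball c δ) :
    ballCoveringNumber δ S ≤ F.card :=
  iInf₂_le F h

/-- An open `δ`-ball contains at most one point of a `2δ`-separated family. -/
theorem le_ballCoveringNumber_of_separated {n : ℕ} {δ : ℝ}
    {S : Set (EuclideanSpace ℝ (Fin n))} {ι : Type*} (I : Finset ι)
    (f : ι → EuclideanSpace ℝ (Fin n)) (hf : ∀ i ∈ I, f i ∈ S)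
    (hsep : ∀ i ∈ I, ∀ j ∈ I, i ≠ j → 2 * δ ≤ dist (f i) (f j)) :
    (I.card : ℕ∞) ≤ ballCoveringNumber δ S := by
  refine le_iInf₂ fun F hF => ?_
  have hex : ∀ i, ∃ c, i ∈ I → c ∈ F ∧ dist (f i) c < δ := fun i => by
    by_cases hi : i ∈ I
    · obtain ⟨c, hc⟩ := mem_iUnion.1 (hF (hf i hi))
      obtain ⟨hcF, hc⟩ := mem_iUnion.1 hc
      exact ⟨c, fun _ => ⟨hcF, hc⟩⟩
    · exact ⟨0, fun h => absurd h hi⟩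
  choose c hc using hex
  refine Nat.cast_le.2 (Finset.card_le_card_of_injOn c (fun i hi => (hc i hi).1) ?_)
  intro i hi j hj hij
  by_contra hne
  have h1 := hsep i hi j hj hne
  have h2 := (hc i hi).2
  have h3 := (hc j hj).2
  rw [← hij] at h3
  have h4 := dist_triangle_right (f i) (f j) (c i)
  linarith

/-- Volume bound for coverings: if the `δ/2`-neighbourhood of `S` lies in a translate of the
`R`-image of the ball of radius `r`, then `S` has a cover whose size is at most the ratio of the
volume of that image to the volume of a `δ/2`-ball. -/
theorem exists_finset_cover_of_subset_linear_image {n : ℕ} {δ r : ℝ} (hδ : 0 < δ) (hr : 0 < r)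
    {S : Set (EuclideanSpace ℝ (Fin n))} (c : EuclideanSpace ℝ (Fin n))
    (R : EuclideanSpace ℝ (Fin n) →ₗ[ℝ] EuclideanSpace ℝ (Fin n))
    (h : ∀ s ∈ S, ∀ e, ‖e‖ < δ / 2 → ∃ y, ‖y‖ < r ∧ s + e = c + R y) :
    ∃ F : Finset (EuclideanSpace ℝ (Fin n)), S ⊆ ⋃ c ∈ F, Metric.ball c δ ∧
      (F.card : ℝ) ≤ (2 * r / δ) ^ n * |LinearMap.det R| := by
  refine exists_finset_cover_of_card_separated_le hδ fun F hFS hsep => ?_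
  let μ : MeasureTheory.Measure (EuclideanSpace ℝ (Fin n)) := MeasureTheory.volume
  have hμ0 : μ (Metric.ball 0 1) ≠ 0 := (Metric.measure_ball_pos μ 0 one_pos).ne'
  have hμt : μ (Metric.ball 0 1) ≠ ⊤ := MeasureTheory.measure_ball_lt_top.ne
  have hdisj : (F : Set (EuclideanSpace ℝ (Fin n))).PairwiseDisjoint
      (fun s => Metric.ball s (δ / 2)) := fun x hx y hy hxy =>
    Metric.ball_disjoint_ball (by linarith [hsep hx hy hxy])
  have hsub : (⋃ s ∈ F, Metric.ball s (δ / 2)) ⊆ (fun y => c + y) '' (R '' Metric.ball 0 r) := by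
    refine iUnion₂_subset fun s hs p hp => ?_
    obtain ⟨y, hy, hy'⟩ := h s (hFS hs) (p - s) (by rwa [← dist_eq_norm])
    exact ⟨R y, ⟨y, by simpa using hy, rfl⟩, by simpa using hy'.symm⟩
  have hm := MeasureTheory.measure_mono (μ := μ) hsub
  rw [MeasureTheory.measure_biUnion_finset hdisj (fun _ _ => measurableSet_ball),
    image_add_left, MeasureTheory.measure_preimage_add,
    MeasureTheory.Measure.addHaar_image_linearMap,
    Finset.sum_congr rfl (fun s _ => MeasureTheory.Measure.addHaar_ball_of_pos μ s
      (half_pos hδ)), Finset.sum_const, MeasureTheory.Measure.addHaar_ball_of_pos μ 0 hr,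
    nsmul_eq_mul, ← mul_assoc, ← mul_assoc, ENNReal.mul_le_mul_iff_left hμ0 hμt,
    ← ENNReal.ofReal_natCast, ← ENNReal.ofReal_mul (by positivity),
    ← ENNReal.ofReal_mul (by positivity), ENNReal.ofReal_le_ofReal_iff (by positivity),
    finrank_euclideanSpace_fin] at hm
  have hp : (0 : ℝ) < (δ / 2) ^ n := by positivity
  have : (2 * r / δ) ^ n * |LinearMap.det R| = |LinearMap.det R| * r ^ n / (δ / 2) ^ n := by
    rw [mul_div_assoc _ (r ^ n), ← div_pow, mul_comm, show r / (δ / 2) = 2 * r / δ by field_simp]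
  rw [this, le_div_iff₀ hp]
  exact hm
open Matrix in
/-- If `S` lies in the `δ/2`-neighbourhood of a translate of the `M`-image of the `δ`-ball, then it
is covered by at most `4ⁿ √det P` balls of radius `δ`, for every `P ≥ 1 + M Mᵀ`. The determinant
`√det (1 + M Mᵀ)` takes the place of the product of `max (1, αᵢ)` over the singular values `αᵢ` of
`M`, from which it differs by a bounded factor only. -/
theorem exists_finset_cover_of_linear_image_add {n : ℕ} {δ : ℝ} (hδ : 0 < δ)
    {S : Set (EuclideanSpace ℝ (Fin n))} (c : EuclideanSpace ℝ (Fin n))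
    {M P : Matrix (Fin n) (Fin n) ℝ} (hP : (P - (1 + M * Mᵀ)).PosSemidef)
    (h : ∀ s ∈ S, ∃ u : EuclideanSpace ℝ (Fin n), ‖u‖ < δ ∧
      ‖s - c - WithLp.toLp 2 (M *ᵥ u.ofLp)‖ ≤ δ / 2) :
    ∃ F : Finset (EuclideanSpace ℝ (Fin n)), S ⊆ ⋃ c ∈ F, Metric.ball c δ ∧
      (F.card : ℝ) ≤ 4 ^ n * √P.det := by
  open scoped MatrixOrder in
  have h1P : (1 + M * Mᵀ).PosDef := by
    refine Matrix.PosDef.one.add_posSemidef ?_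
    simpa using Matrix.posSemidef_self_mul_conjTranspose M
  have hPd : P.PosDef := by
    simpa using h1P.add_posSemidef hP
  obtain ⟨R, hR⟩ : ∃ R : Matrix (Fin n) (Fin n) ℝ, P = Rᵀ * R := by
    obtain ⟨R, hR⟩ := CStarAlgebra.nonneg_iff_eq_star_mul_self.mp hPd.posSemidef.nonneg
    exact ⟨R, by simpa [Matrix.star_eq_conjTranspose] using hR⟩
  have hdet : P.det = R.det ^ 2 := by rw [hR, det_mul, det_transpose, sq]
  -- With `P = Rᵀ R`, the set of all `M u + v` with `‖u‖, ‖v‖ < δ` lies in the `Rᵀ`-image of the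
  -- ball of radius `2 δ`: if `M u + v = P q`, then `‖R q‖² = ⟨Mᵀ q, u⟩ + ⟨q, v⟩` and
  -- `‖Mᵀ q‖² + ‖q‖² ≤ ⟨q, P q⟩ = ‖R q‖²`.
  have hnorm : ∀ x : Fin n → ℝ, ‖WithLp.toLp 2 x‖ ^ 2 = x ⬝ᵥ x := fun x => by
    rw [EuclideanSpace.real_norm_sq_eq]
    exact Finset.sum_congr rfl fun i _ => sq _
  have hyoung : ∀ x y : Fin n → ℝ, 2 * (x ⬝ᵥ y) ≤ x ⬝ᵥ x + y ⬝ᵥ y := fun x y => by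
    have h0 : 0 ≤ (x - y) ⬝ᵥ (x - y) := by
      rw [← hnorm]; positivity
    rw [sub_dotProduct, dotProduct_sub, dotProduct_sub, dotProduct_comm y x] at h0
    linarith
  have hmain : ∀ s ∈ S, ∀ e, ‖e‖ < δ / 2 → ∃ y, ‖y‖ < 2 * δ ∧ s + e = c + Rᵀ.toLpLin 2 2 y := by
    intro s hs e he
    obtain ⟨u, hu, hsu⟩ := h s hs
    set v : EuclideanSpace ℝ (Fin n) := s - c - WithLp.toLp 2 (M *ᵥ u.ofLp) + e with hv
    have hvn : ‖v‖ < δ := (norm_add_le _ _).trans_lt (by linarith)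
    obtain ⟨w, hw⟩ : ∃ w, w = M *ᵥ u.ofLp + v.ofLp := ⟨_, rfl⟩
    obtain ⟨q, hq⟩ : ∃ q, q = P⁻¹ *ᵥ w := ⟨_, rfl⟩
    have hPq : P *ᵥ q = w := by
      rw [hq, mulVec_mulVec, mul_nonsing_inv _ (isUnit_iff_ne_zero.2 hPd.det_pos.ne'), one_mulVec]
    have hyw : Rᵀ *ᵥ (R *ᵥ q) = w := by rw [mulVec_mulVec, ← hR, hPq]
    refine ⟨WithLp.toLp 2 (R *ᵥ q), ?_, ?_⟩
    · have h1 : (R *ᵥ q) ⬝ᵥ (R *ᵥ q) = q ⬝ᵥ w := by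
        rw [← hyw, dotProduct_mulVec q, vecMul_transpose]
      have h2 : q ⬝ᵥ w = (Mᵀ *ᵥ q) ⬝ᵥ u.ofLp + q ⬝ᵥ v.ofLp := by
        rw [hw, dotProduct_add, dotProduct_mulVec, ← mulVec_transpose]
      have h3 : q ⬝ᵥ q + (Mᵀ *ᵥ q) ⬝ᵥ (Mᵀ *ᵥ q) ≤ q ⬝ᵥ w := by
        have := hP.dotProduct_mulVec_nonneg q
        rw [sub_mulVec, add_mulVec, hPq, one_mulVec, ← mulVec_mulVec, star_trivial, dotProduct_sub,
          dotProduct_add, dotProduct_mulVec q M, ← mulVec_transpose] at this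
        linarith
      have h4 := hyoung (Mᵀ *ᵥ q) u.ofLp
      have h5 := hyoung q v.ofLp
      have h6 : u.ofLp ⬝ᵥ u.ofLp = ‖u‖ ^ 2 := (hnorm u.ofLp).symm
      have h7 : v.ofLp ⬝ᵥ v.ofLp = ‖v‖ ^ 2 := (hnorm v.ofLp).symm
      refine lt_of_pow_lt_pow_left₀ 2 (by positivity) ?_
      rw [hnorm]
      have h8 : ‖u‖ ^ 2 < δ ^ 2 := pow_lt_pow_left₀ hu (norm_nonneg _) two_ne_zero
      have h9 : ‖v‖ ^ 2 < δ ^ 2 := pow_lt_pow_left₀ hvn (norm_nonneg _) two_ne_zero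
      nlinarith
    · rw [toLpLin_toLp, toLin'_apply, hyw, hw, hv]
      ext i
      simp only [PiLp.add_apply, PiLp.sub_apply, Pi.add_apply]
      ring
  obtain ⟨F, hF, hFc⟩ := exists_finset_cover_of_subset_linear_image hδ
    (mul_pos two_pos hδ) c (Rᵀ.toLpLin 2 2) hmain
  refine ⟨F, hF, hFc.trans (le_of_eq ?_)⟩
  rw [hdet, Real.sqrt_sq_eq_abs, show 2 * (2 * δ) / δ = 4 by field_simp; norm_num]
  simp

/-! ### Orbits of the Lanford system -/

/-- The Jacobian matrix of the Lanford field at `p`. -/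
noncomputable def lanfordJacobian (a : ℝ) (p : EuclideanSpace ℝ (Fin 3)) :
    Matrix (Fin 3) (Fin 3) ℝ :=
  !![a - 1 + p 2, -1, p 0; 1, a - 1 + p 2, p 1; -2 * p 0, -2 * p 1, a - 2 * p 2]

theorem hasDerivWithinAt_lanford_coord {a : ℝ} {γ : ℝ → EuclideanSpace ℝ (Fin 3)} {s : Set ℝ}
    (hγ : IsIntegralCurveOn γ (fun _ => lanfordField a) s) {t : ℝ} (ht : t ∈ s) :
    HasDerivWithinAt (fun s => γ s 0) ((a - 1) * γ t 0 - γ t 1 + γ t 0 * γ t 2) s t ∧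
    HasDerivWithinAt (fun s => γ s 1) (γ t 0 + (a - 1) * γ t 1 + γ t 1 * γ t 2) s t ∧
    HasDerivWithinAt (fun s => γ s 2) (a * γ t 2 - (γ t 0 ^ 2 + γ t 1 ^ 2 + γ t 2 ^ 2)) s t := by
  have h : ∀ i, HasDerivWithinAt (fun s => γ s i) (lanfordField a (γ t) i) s t := fun i =>
    (EuclideanSpace.proj (𝕜 := ℝ) i).hasFDerivAt.comp_hasDerivWithinAt t (hγ t ht)
  exact ⟨h 0, h 1, h 2⟩

theorem IsForwardInvariantSet.mem_of_isIntegralCurveOn {n : ℕ}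
    {φ : EuclideanSpace ℝ (Fin n) → EuclideanSpace ℝ (Fin n)}
    {K : Set (EuclideanSpace ℝ (Fin n))} (hK : IsForwardInvariantSet φ K)
    {γ : ℝ → EuclideanSpace ℝ (Fin n)} {T : ℝ}
    (hγ : IsIntegralCurveOn γ (fun _ => φ) (Icc 0 T)) (h0 : γ 0 ∈ K) {t : ℝ} (ht : t ∈ Icc 0 T) :
    γ t ∈ K :=
  hK.2 t ht.1 ⟨γ, hγ.mono (Icc_subset_Icc_right ht.2), h0, rfl⟩

/-- From `z' ≤ a z`, an orbit with `z(0) < 0` has `z(t) ≤ z(0) exp (a t)`, which is unbounded. -/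
theorem lanford_z_nonneg {a : ℝ} (ha : 0 < a) {K : Set (EuclideanSpace ℝ (Fin 3))}
    (hK : IsCompact K) (hinv : IsForwardInvariantSet (lanfordField a) K)
    {p : EuclideanSpace ℝ (Fin 3)} (hp : p ∈ K) : 0 ≤ p 2 := by
  by_contra! hneg
  obtain ⟨γ, h0, hγ⟩ := hinv.1 p hp
  obtain ⟨B, hB⟩ := hK.isBounded.exists_norm_le
  have hB0 : 0 ≤ B := (norm_nonneg _).trans (hB p hp)
  -- At this time the linear lower bound of the exponential already exceeds `B`.
  set T : ℝ := B / (a * -(p 2)) with hT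
  have hT0 : 0 ≤ T := div_nonneg hB0 (mul_nonneg ha.le (by linarith))
  have hγT : IsIntegralCurveOn γ (fun _ => lanfordField a) (Icc 0 T) :=
    hγ.mono Icc_subset_Ici_self
  have hTT : T ∈ Icc 0 T := ⟨hT0, le_rfl⟩
  have hz := le_mul_exp_of_hasDerivWithinAt_le (g := fun t => a * t) (g' := fun _ => a)
    (fun t ht => (hasDerivWithinAt_lanford_coord hγT ht).2.2)
    (fun t _ => by simpa using ((hasDerivAt_id t).const_mul a).hasDerivWithinAt)
    (fun t _ => by nlinarith [sq_nonneg (γ t 0), sq_nonneg (γ t 1), sq_nonneg (γ t 2)]) hTT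
  have hmem : γ T ∈ K := hinv.mem_of_isIntegralCurveOn hγT (by rwa [h0]) hTT
  have h1 := (abs_le.1 ((PiLp.norm_apply_le (γ T) 2).trans (hB _ hmem))).1
  have h2 := Real.add_one_le_exp (a * T)
  have h3 : a * T * -(p 2) = B := by
    have := hneg.ne
    rw [hT]; field_simp
  rw [h0] at hz
  simp only [mul_zero, sub_zero] at hz
  nlinarith

theorem exists_lanford_z_mem_Icc {a : ℝ} (ha : 0 < a) {K : Set (EuclideanSpace ℝ (Fin 3))}
    (hK : IsCompact K) (hinv : IsForwardInvariantSet (lanfordField a) K) :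
    ∃ Z : ℝ, 0 ≤ Z ∧ ∀ p ∈ K, p 2 ∈ Icc 0 Z := by
  obtain ⟨B, hB⟩ := hK.isBounded.exists_norm_le
  refine ⟨|B|, abs_nonneg _, fun p hp => ⟨lanford_z_nonneg ha hK hinv hp, ?_⟩⟩
  exact (le_abs_self _).trans ((PiLp.norm_apply_le p 2).trans ((hB p hp).trans (le_abs_self _)))

/-- The excess of `z` over `a` decays exponentially, because
`(z - a)' = -a (z - a) - (z - a)² - x² - y²`. -/
theorem lanford_z_le {a T : ℝ} {γ : ℝ → EuclideanSpace ℝ (Fin 3)}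
    (hγ : IsIntegralCurveOn γ (fun _ => lanfordField a) (Icc 0 T)) {t : ℝ} (ht : t ∈ Icc 0 T) :
    γ t 2 ≤ a + (γ 0 2 - a) * Real.exp (-a * t) := by
  have hz := le_mul_exp_of_hasDerivWithinAt_le (y := fun t => γ t 2 - a)
    (g := fun t => -a * t) (g' := fun _ => -a)
    (fun t ht => (hasDerivWithinAt_lanford_coord hγ ht).2.2.sub_const a)
    (fun t _ => by simpa using ((hasDerivAt_id t).const_mul (-a)).hasDerivWithinAt)
    (fun t _ => by nlinarith [sq_nonneg (γ t 0), sq_nonneg (γ t 1), sq_nonneg (γ t 2 - a)]) ht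
  simp only [mul_zero, sub_zero] at hz
  linarith

/-- The square of the distance of two points in the metric that makes the symmetric part of the
Lanford Jacobian diagonal. -/
noncomputable def lanfordDistSq (p q : EuclideanSpace ℝ (Fin 3)) : ℝ :=
  (p 0 - q 0) ^ 2 + (p 1 - q 1) ^ 2 + (p 2 - q 2) ^ 2 / 2

theorem norm_sub_sq_le_two_mul_lanfordDistSq (p q : EuclideanSpace ℝ (Fin 3)) :
    ‖p - q‖ ^ 2 ≤ 2 * lanfordDistSq p q := by
  rw [EuclideanSpace.real_norm_sq_eq, Fin.sum_univ_three, lanfordDistSq]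
  simp only [PiLp.sub_apply]
  nlinarith [sq_nonneg (p 0 - q 0), sq_nonneg (p 1 - q 1)]

theorem lanfordDistSq_le_norm_sub_sq (p q : EuclideanSpace ℝ (Fin 3)) :
    lanfordDistSq p q ≤ ‖p - q‖ ^ 2 := by
  rw [EuclideanSpace.real_norm_sq_eq, Fin.sum_univ_three, lanfordDistSq]
  simp only [PiLp.sub_apply]
  nlinarith [sq_nonneg (p 2 - q 2)]

theorem lanfordDistSq_le_mul_exp {a T Z : ℝ} (hZ : 0 ≤ Z)
    {γ η : ℝ → EuclideanSpace ℝ (Fin 3)}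
    (hγ : IsIntegralCurveOn γ (fun _ => lanfordField a) (Icc 0 T))
    (hη : IsIntegralCurveOn η (fun _ => lanfordField a) (Icc 0 T))
    (hγz : ∀ t ∈ Icc 0 T, γ t 2 ∈ Icc 0 Z) (hηz : ∀ t ∈ Icc 0 T, η t 2 ∈ Icc 0 Z)
    {t : ℝ} (ht : t ∈ Icc 0 T) :
    lanfordDistSq (γ t) (η t) ≤ lanfordDistSq (γ 0) (η 0) * Real.exp (2 * (a + Z) * t) := by
  have h := le_mul_exp_of_hasDerivWithinAt_le (y := fun t => lanfordDistSq (γ t) (η t))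
    (g := fun t => 2 * (a + Z) * t) (g' := fun _ => 2 * (a + Z))
    (fun t ht => by
      obtain ⟨hx, hy, hz⟩ := hasDerivWithinAt_lanford_coord hγ ht
      obtain ⟨hx', hy', hz'⟩ := hasDerivWithinAt_lanford_coord hη ht
      exact (((hx.sub hx').pow 2).add ((hy.sub hy').pow 2)).add (((hz.sub hz').pow 2).div_const 2))
    (fun t _ => by simpa using ((hasDerivAt_id t).const_mul (2 * (a + Z))).hasDerivWithinAt)
    (fun t ht => by
      obtain ⟨h1, h2⟩ := hγz t ht
      obtain ⟨h3, h4⟩ := hηz t ht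
      have e1 : 0 ≤ (2 * (a + Z) - (2 * (a - 1) + (γ t 2 + η t 2)))
        * ((γ t 0 - η t 0) ^ 2 + (γ t 1 - η t 1) ^ 2) :=
        mul_nonneg (by linarith) (by positivity)
      have e2 : 0 ≤ (a + Z - (a - (γ t 2 + η t 2))) * (γ t 2 - η t 2) ^ 2 :=
        mul_nonneg (by linarith) (by positivity)
      simp only [lanfordDistSq, Pi.sub_apply]
      simp only [Nat.cast_ofNat, Nat.add_one_sub_one, pow_one]
      linarith) ht
  simpa using h

/-- The linearized flow along `η` describes the difference `γ - η` up to an error that is quadratic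
in the initial difference (both sides of the estimate are squared). The field is a quadratic
polynomial, so its increment is the Jacobian applied to the difference `w = γ - η`, plus
`(w₀ w₂, w₁ w₂, -|w|²)`. -/
theorem lanford_linearization_error {a T Z : ℝ} (ha : 0 < a) (hZ : 0 ≤ Z)
    {γ η : ℝ → EuclideanSpace ℝ (Fin 3)}
    (hγ : IsIntegralCurveOn γ (fun _ => lanfordField a) (Icc 0 T))
    (hη : IsIntegralCurveOn η (fun _ => lanfordField a) (Icc 0 T))
    (hγz : ∀ t ∈ Icc 0 T, γ t 2 ∈ Icc 0 Z) (hηz : ∀ t ∈ Icc 0 T, η t 2 ∈ Icc 0 Z)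
    {m : ℝ → EuclideanSpace ℝ (Fin 3)} (hm0 : m 0 = γ 0 - η 0)
    (hm : ∀ t ∈ Icc 0 T, ∀ i, HasDerivWithinAt (fun s => m s i)
      ((lanfordJacobian a (η t)).mulVec (m t).ofLp i) (Icc 0 T) t)
    (hT : 0 ≤ T) :
    lanfordDistSq (γ T) (η T + m T) ≤
      4 * lanfordDistSq (γ 0) (η 0) ^ 2 * Real.exp (4 * (a + Z) * T + (2 * (a + Z) + 1) * T) := by
  set L := a + Z with hL
  set C := 4 * lanfordDistSq (γ 0) (η 0) ^ 2 * Real.exp (4 * L * T) with hC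
  have hC0 : 0 ≤ C := by positivity
  -- The squared error `E` satisfies `E' ≤ (2 L + 1) E + C`; adding `C` makes this homogeneous.
  have h := le_mul_exp_of_hasDerivWithinAt_le (y := fun t => lanfordDistSq (γ t) (η t + m t) + C)
    (g := fun t => (2 * L + 1) * t) (g' := fun _ => 2 * L + 1)
    (fun t ht => by
      obtain ⟨hx, hy, hz⟩ := hasDerivWithinAt_lanford_coord hγ ht
      obtain ⟨hx', hy', hz'⟩ := hasDerivWithinAt_lanford_coord hη ht
      exact ((((hx.sub (hx'.add (hm t ht 0))).pow 2).add ((hy.sub (hy'.add (hm t ht 1))).pow 2)).add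
        (((hz.sub (hz'.add (hm t ht 2))).pow 2).div_const 2)).add_const C)
    (fun t _ => by simpa using ((hasDerivAt_id t).const_mul (2 * L + 1)).hasDerivWithinAt)
    (fun t ht => by
      obtain ⟨h3, h4⟩ := hηz t ht
      have hV := lanfordDistSq_le_mul_exp hZ hγ hη hγz hηz ht
      have hVC : 4 * lanfordDistSq (γ t) (η t) ^ 2 ≤ C := by
        have hV0 : 0 ≤ lanfordDistSq (γ t) (η t) := by unfold lanfordDistSq; positivity
        have h1 := pow_le_pow_left₀ hV0 hV 2
        rw [mul_pow, ← Real.exp_nat_mul] at h1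
        have h2 : Real.exp (((2 : ℕ) : ℝ) * (2 * (a + Z) * t)) ≤ Real.exp (4 * L * T) := by
          refine Real.exp_le_exp.2 ?_
          have := mul_le_mul_of_nonneg_left ht.2 (show 0 ≤ 4 * L by positivity)
          push_cast
          linarith
        have h5 := mul_le_mul_of_nonneg_left h2 (sq_nonneg (lanfordDistSq (γ 0) (η 0)))
        rw [hC]
        linarith
      simp only [lanfordDistSq] at hVC
      simp only [lanfordDistSq, Pi.sub_apply, Pi.add_apply, lanfordJacobian, PiLp.add_apply]
      simp only [Matrix.mulVec, dotProduct, Fin.sum_univ_three, Matrix.of_apply,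
        Matrix.cons_val', Matrix.cons_val, Nat.cast_ofNat, Nat.add_one_sub_one, pow_one]
      generalize γ t 0 = x at *
      generalize γ t 1 = y at *
      generalize γ t 2 = z at *
      generalize (η t 0) = x' at *
      generalize (η t 1) = y' at *
      generalize (η t 2) = z' at *
      generalize (m t) 0 = m0 at *
      generalize (m t) 1 = m1 at *
      generalize (m t) 2 = m2 at *
      -- `w` is the difference of the two orbits, `e` the error of the linearization.
      obtain ⟨w0, rfl⟩ : ∃ w, x = x' + w := ⟨x - x', by ring⟩
      obtain ⟨w1, rfl⟩ : ∃ w, y = y' + w := ⟨y - y', by ring⟩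
      obtain ⟨w2, rfl⟩ : ∃ w, z = z' + w := ⟨z - z', by ring⟩
      obtain ⟨e0, rfl⟩ : ∃ w, m0 = w0 - w := ⟨w0 - m0, by ring⟩
      obtain ⟨e1, rfl⟩ : ∃ w, m1 = w1 - w := ⟨w1 - m1, by ring⟩
      obtain ⟨e2, rfl⟩ : ∃ w, m2 = w2 - w := ⟨w2 - m2, by ring⟩
      have f1 : 0 ≤ (L - (a - 1 + z')) * (e0 ^ 2 + e1 ^ 2) :=
        mul_nonneg (by linarith) (by positivity)
      have f2 : 0 ≤ (L - (a - 2 * z')) * e2 ^ 2 :=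
        mul_nonneg (by linarith) (by positivity)
      have f3 : 0 ≤ (2 * L + 1) * C - C := by
        have : 0 ≤ 2 * L * C := by positivity
        linarith
      have f4 : 0 ≤ 4 * ((x' + w0 - x') ^ 2 + (y' + w1 - y') ^ 2 + (z' + w2 - z') ^ 2 / 2) ^ 2
          - ((w0 ^ 2 + w1 ^ 2) * w2 ^ 2 + (w0 ^ 2 + w1 ^ 2 + w2 ^ 2) ^ 2 / 2) := by
        have : 4 * ((x' + w0 - x') ^ 2 + (y' + w1 - y') ^ 2 + (z' + w2 - z') ^ 2 / 2) ^ 2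
          - ((w0 ^ 2 + w1 ^ 2) * w2 ^ 2 + (w0 ^ 2 + w1 ^ 2 + w2 ^ 2) ^ 2 / 2) =
          7 / 2 * (w0 ^ 2 + w1 ^ 2) ^ 2 + 2 * (w0 ^ 2 + w1 ^ 2) * w2 ^ 2 + w2 ^ 4 / 2 := by ring
        rw [this]; positivity
      have f5 := sq_nonneg (e0 - w0 * w2)
      have f6 := sq_nonneg (e1 - w1 * w2)
      have f7 := sq_nonneg (e2 + (w0 ^ 2 + w1 ^ 2 + w2 ^ 2))
      linarith) (right_mem_Icc.2 hT)
  have h0 : lanfordDistSq (γ 0) (η 0 + m 0) = 0 := by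
    rw [hm0, add_sub_cancel]; simp [lanfordDistSq]
  simp only [h0, mul_zero, sub_zero, zero_add] at h
  rw [Real.exp_add, ← mul_assoc]
  linarith

/-! ### Growth of the determinant and the upper bound -/

open Matrix in
/-- The fundamental matrix of the linearization along an orbit. -/
theorem exists_lanford_fundamental_matrix {a T : ℝ} (hT : 0 ≤ T)
    {η : ℝ → EuclideanSpace ℝ (Fin 3)}
    (hη : IsIntegralCurveOn η (fun _ => lanfordField a) (Icc 0 T)) :
    ∃ M : ℝ → Matrix (Fin 3) (Fin 3) ℝ, M 0 = 1 ∧ ∀ t ∈ Icc 0 T, ∀ i k,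
      HasDerivWithinAt (fun s => M s i k) ((lanfordJacobian a (η t) * M t) i k) (Icc 0 T) t := by
  let Φ : Matrix (Fin 3) (Fin 3) ℝ →ₗ[ℝ] ((Fin 3 → ℝ) →L[ℝ] (Fin 3 → ℝ)) :=
    (LinearMap.toContinuousLinearMap (𝕜 := ℝ)).toLinearMap ∘ₗ (Matrix.toLin' (R := ℝ)).toLinearMap
  have hΦ : Continuous Φ := Φ.continuous_of_finiteDimensional
  have hJ : Continuous (lanfordJacobian a) := by
    refine continuous_matrix fun i j => ?_
    fin_cases i <;> fin_cases j <;> simp [lanfordJacobian] <;> fun_prop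
  have hA : ContinuousOn (fun t => Φ (lanfordJacobian a (η t))) (Icc 0 T) :=
    (hΦ.comp hJ).comp_continuousOn hη.continuousOn
  choose m hm0 hm using fun k : Fin 3 =>
    exists_forall_hasDerivWithinAt_linear hT hA (Pi.single k 1)
  refine ⟨fun t => Matrix.of fun i k => m k t i, ?_, fun t ht i k => ?_⟩
  · ext i k
    simp [hm0, Matrix.one_apply, Pi.single_apply]
  · exact hasDerivWithinAt_pi.1 (hm k t ht) i

/-- The expression on the left is linear in each of `α`, `β`, `δ` in `[0, D]`; its maximum over the
cube is `2 D` times the largest sum of a subfamily of `h, h, v`. -/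
theorem weighted_trace_le {D c σ h v α β δ : ℝ} (hσ : 0 ≤ σ) (hc : 0 ≤ c)
    (a0 : 0 ≤ α) (a1 : α ≤ D) (b0 : 0 ≤ β) (b1 : β ≤ D) (c0 : 0 ≤ δ) (c1 : δ ≤ D)
    (h1 : h ≤ σ + c) (h2 : h + h + v ≤ 2 * σ) (h3 : v ≤ 2 * σ) :
    2 * (h * (α + β) + v * δ) ≤ (4 * σ + 4 * c) * D := by
  have hD0 : 0 ≤ D := a0.trans a1
  have hcD := mul_nonneg hc hD0
  have hσD := mul_nonneg hσ hD0
  have k1 := mul_nonneg (sub_nonneg.2 h1) hD0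
  have k2 := mul_nonneg (sub_nonneg.2 h2) hD0
  have k3 := mul_nonneg (sub_nonneg.2 h3) hD0
  have hh : h * (α + β) ≤ 2 * h * D ∨ h * (α + β) ≤ 0 := by
    rcases le_total 0 h with hh | hh
    · exact Or.inl (by linarith [mul_nonneg hh (sub_nonneg.2 (add_le_add a1 b1))])
    · exact Or.inr (mul_nonpos_of_nonpos_of_nonneg hh (add_nonneg a0 b0))
  have hv : v * δ ≤ v * D ∨ v * δ ≤ 0 := by
    rcases le_total 0 v with hv | hv
    · exact Or.inl (mul_le_mul_of_nonneg_left c1 hv)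
    · exact Or.inr (mul_nonpos_of_nonpos_of_nonneg hv c0)
  rcases hh with hh | hh <;> rcases hv with hv | hv <;> linarith

open Matrix in
/-- The growth of `det (W + M Mᵀ)` along an orbit, `W = diag (1, 1, 2)`. With `P = W + M Mᵀ`,
`(log det P)' = 2 tr (J (P - W) P⁻¹) = 2 tr (J (1 - W P⁻¹))`. The symmetric part of `J W` is
`diag (h, h, 2 v)` with `h = a - 1 + z` and `v = a - 2 z`, so only the diagonal entries of `W P⁻¹`
enter, and these lie in `[0, 1]`. Hence `(log det P)'` is at most twice the sum of the positive
ones among `h, h, v`. Since `z ≥ 0` and `z ≤ a + C exp (-a t)`, this sum is at most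
`2 (2 a - 1) + 2 C exp (-a t)`: for `h + h` by the bound on `z`, for `v ≤ a` by `a ≥ 2/3`; the
remaining sums `h`, `h + v = 2 a - 1 - z` and `h + h + v = 3 a - 2` satisfy the same bound. -/
theorem lanford_det_le {a T C : ℝ} (ha : 2 / 3 ≤ a) (hC : 0 ≤ C) (hT : 0 ≤ T)
    {η : ℝ → EuclideanSpace ℝ (Fin 3)}
    (hηz : ∀ t ∈ Icc 0 T, 0 ≤ η t 2 ∧ η t 2 ≤ a + C * Real.exp (-a * t))
    {M : ℝ → Matrix (Fin 3) (Fin 3) ℝ} (hM0 : M 0 = 1)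
    (hM : ∀ t ∈ Icc 0 T, ∀ i k,
      HasDerivWithinAt (fun s => M s i k) ((lanfordJacobian a (η t) * M t) i k) (Icc 0 T) t) :
    (diagonal ![1, 1, 2] + M T * (M T)ᵀ).det ≤
      12 * Real.exp (4 * (2 * a - 1) * T + 4 * C / a) := by
  have ha0 : 0 < a := by linarith
  set N : ℝ → Matrix (Fin 3) (Fin 3) ℝ := fun t => M t * (M t)ᵀ with hNdef
  have hN : ∀ t ∈ Icc 0 T, ∀ i j, HasDerivWithinAt (fun s => N s i j)
      ((lanfordJacobian a (η t) * N t + N t * (lanfordJacobian a (η t))ᵀ) i j) (Icc 0 T) t := by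
    intro t ht i j
    have h := HasDerivWithinAt.fun_sum (u := Finset.univ)
      fun k _ => (hM t ht i k).mul (hM t ht j k)
    refine h.congr_deriv ?_
    rw [hNdef, Matrix.add_apply, ← Matrix.mul_assoc, Matrix.mul_assoc (M t), ← transpose_mul,
      Matrix.mul_apply, Matrix.mul_apply, ← Finset.sum_add_distrib]
    rfl
  have hsymm : ∀ t i j, N t i j = N t j i := fun t i j => by
    have : (N t)ᵀ = N t := by simp [hNdef]
    exact congrFun (congrFun this j) i
  have hpsd : ∀ t (d : Fin 3 → ℝ), 0 ≤ d → (diagonal d + N t).PosSemidef := fun t d hd =>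
    (PosSemidef.diagonal hd).add (by simpa using posSemidef_self_mul_conjTranspose (M t))
  have hdet : ∀ t (d : Fin 3 → ℝ), (diagonal d + N t).det =
      (d 0 + N t 0 0) * ((d 1 + N t 1 1) * (d 2 + N t 2 2) - N t 1 2 ^ 2)
      - N t 0 1 * (N t 0 1 * (d 2 + N t 2 2) - N t 0 2 * N t 1 2)
      + N t 0 2 * (N t 0 1 * N t 1 2 - (d 1 + N t 1 1) * N t 0 2) := fun t d => by
    rw [det_fin_three]
    simp [hsymm t 1 0, hsymm t 2 0, hsymm t 2 1]
    ring
  have hmin : ∀ t (i j : Fin 3), i ≠ j → ∀ d : Fin 3 → ℝ, 0 ≤ d →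
      0 ≤ (d i + N t i i) * (d j + N t j j) - N t i j ^ 2 := fun t i j hij d hd => by
    have h := ((hpsd t d hd).submatrix ![i, j]).det_nonneg
    rw [det_fin_two] at h
    simp [hij, hij.symm, hsymm t j i] at h
    linarith
  -- The function `y` below is `det (W + N)` written out, and `g` is a primitive of the bound
  -- for its logarithmic derivative.
  set g : ℝ → ℝ := fun t => 4 * (2 * a - 1) * t - 4 * C / a * Real.exp (-a * t) with hg
  have key := le_mul_exp_of_hasDerivWithinAt_le
    (y := fun t => (1 + N t 0 0) * ((1 + N t 1 1) * (2 + N t 2 2) - N t 1 2 ^ 2)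
      - N t 0 1 * (N t 0 1 * (2 + N t 2 2) - N t 0 2 * N t 1 2)
      + N t 0 2 * (N t 0 1 * N t 1 2 - (1 + N t 1 1) * N t 0 2))
    (g := g) (g' := fun t => 4 * (2 * a - 1) + 4 * (C * Real.exp (-a * t)))
    (fun t ht => by
      have h := hN t ht
      exact ((((h 0 0).const_add 1).mul ((((h 1 1).const_add 1).mul ((h 2 2).const_add 2)).sub
          ((h 1 2).pow 2))).sub
        ((h 0 1).mul (((h 0 1).mul ((h 2 2).const_add 2)).sub ((h 0 2).mul (h 1 2))))).add
        ((h 0 2).mul (((h 0 1).mul (h 1 2)).sub (((h 1 1).const_add 1).mul (h 0 2)))))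
    (fun t _ => by
      have h1 := (((hasDerivAt_id t).const_mul (-a)).exp.const_mul (4 * C / a))
      have h2 := (((hasDerivAt_id t).const_mul (4 * (2 * a - 1))).sub h1).hasDerivWithinAt
        (s := Icc 0 T)
      refine h2.congr_deriv ?_
      simp only [id]
      field_simp
      ring)
    (fun t ht => by
      obtain ⟨hz0, hz1⟩ := hηz t ht
      have hc : 0 ≤ C * Real.exp (-a * t) := by positivity
      -- Lowering one entry of `W` to `0` keeps the matrix positive semidefinite. The determinants
      -- `d1`, `d2`, `d3` so obtained are `det P` times the diagonal entries of `1 - W P⁻¹`.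
      have d1 := (hpsd t ![0, 1, 2] (by intro i; fin_cases i <;> simp)).det_nonneg
      have d2 := (hpsd t ![1, 0, 2] (by intro i; fin_cases i <;> simp)).det_nonneg
      have d3 := (hpsd t ![1, 1, 0] (by intro i; fin_cases i <;> simp)).det_nonneg
      have m1 := hmin t 1 2 (by decide) ![1, 1, 2] (by intro i; fin_cases i <;> simp)
      have m2 := hmin t 0 2 (by decide) ![1, 1, 2] (by intro i; fin_cases i <;> simp)
      have m3 := hmin t 0 1 (by decide) ![1, 1, 2] (by intro i; fin_cases i <;> simp)
      rw [hdet] at d1 d2 d3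
      simp only [Matrix.cons_val, zero_add] at d1 d2 d3 m1 m2 m3
      simp only [Matrix.add_apply, Matrix.mul_apply, Fin.sum_univ_three, Matrix.transpose_apply,
        lanfordJacobian, Matrix.of_apply, Matrix.cons_val, Matrix.cons_val',
        hsymm t 1 0, hsymm t 2 0, hsymm t 2 1, Pi.mul_apply, Pi.sub_apply, Pi.pow_apply,
        Nat.cast_ofNat, Nat.add_one_sub_one, pow_one]
      generalize C * Real.exp (-a * t) = c at *
      generalize N t 0 0 = n00 at *
      generalize N t 0 1 = n01 at *
      generalize N t 0 2 = n02 at *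
      generalize N t 1 1 = n11 at *
      generalize N t 1 2 = n12 at *
      generalize N t 2 2 = n22 at *
      generalize (η t) 0 = x at *
      generalize (η t) 1 = y at *
      generalize (η t) 2 = z at *
      set D := (1 + n00) * ((1 + n11) * (2 + n22) - n12 ^ 2) - n01 * (n01 * (2 + n22) - n02 * n12) +
        n02 * (n01 * n12 - (1 + n11) * n02) with hD
      refine le_trans (le_of_eq ?_) (weighted_trace_le (h := a - 1 + z)
        (v := a - 2 * z) (σ := 2 * a - 1) (by linarith) hc d1 ?_ d2 ?_ d3 ?_ ?_ ?_ ?_)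
      · ring
      · rw [hD]; linarith
      · rw [hD]; linarith
      · rw [hD]; linarith
      · linarith
      · linarith
      · linarith) (right_mem_Icc.2 hT)
  have hd := hdet T ![1, 1, 2]
  simp only [Matrix.cons_val] at hd
  rw [hd]
  refine key.trans ?_
  have h0 : N 0 = 1 := by simp [hNdef, hM0]
  have h12 : (1 + N 0 0 0) * ((1 + N 0 1 1) * (2 + N 0 2 2) - N 0 1 2 ^ 2)
      - N 0 0 1 * (N 0 0 1 * (2 + N 0 2 2) - N 0 0 2 * N 0 1 2)
      + N 0 0 2 * (N 0 0 1 * N 0 1 2 - (1 + N 0 1 1) * N 0 0 2) = 12 := by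
    simp +decide only [h0, Matrix.one_apply, if_true, if_false]
    norm_num
  rw [h12]
  refine mul_le_mul_of_nonneg_left (Real.exp_le_exp.2 ?_) (by norm_num)
  have h5 : 0 ≤ 4 * C / a * Real.exp (-a * T) := by positivity
  simp only [hg, mul_zero, Real.exp_zero]
  linarith

open Matrix in
/-- The upper bound: for each `τ` and all small `δ`, uniformly over `q ∈ K`, the image of the
`δ`-ball is covered by `O(exp (2 (2 a - 1) τ))` balls of radius `δ`. -/
theorem exists_lanford_cover {a : ℝ} (ha : 2 / 3 ≤ a) {K : Set (EuclideanSpace ℝ (Fin 3))}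
    (hK : IsCompact K) (hinv : IsForwardInvariantSet (lanfordField a) K) :
    ∃ C : ℝ, ∀ τ : ℝ, 0 ≤ τ → ∀ᶠ δ in 𝓝[>] (0 : ℝ), ∀ q ∈ K,
      ∃ F : Finset (EuclideanSpace ℝ (Fin 3)),
        flowImage (lanfordField a) τ (Metric.ball q δ ∩ K) ⊆ ⋃ c ∈ F, Metric.ball c δ ∧
        (F.card : ℝ) ≤ Real.exp (C + 2 * (2 * a - 1) * τ) := by
  have ha0 : 0 < a := by linarith
  obtain ⟨Z, hZ0, hZ⟩ := exists_lanford_z_mem_Icc ha0 hK hinv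
  -- The factor `12` is `det (W + 1)`.
  refine ⟨Real.log (4 ^ 3 * √12) + 2 * Z / a, fun τ hτ => ?_⟩
  set B := Real.exp (4 * (a + Z) * τ + (2 * (a + Z) + 1) * τ) with hB
  have hB0 : 0 < B := Real.exp_pos _
  -- This makes the quadratic error of the linearization at most `δ / 2`.
  have hsmall : ∀ᶠ δ in 𝓝[>] (0 : ℝ), 8 * B * δ ^ 2 < 1 / 4 := by
    have : Tendsto (fun δ : ℝ => 8 * B * δ ^ 2) (𝓝[>] 0) (𝓝 (8 * B * 0 ^ 2)) :=
      ((continuous_const.mul (continuous_pow 2)).tendsto 0).mono_left nhdsWithin_le_nhds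
    exact this.eventually_lt_const (by norm_num)
  filter_upwards [hsmall, self_mem_nhdsWithin] with δ hδB hδ q hq
  have hδ : 0 < δ := hδ
  obtain ⟨η, hη0, hη⟩ := hinv.1 q hq
  replace hη : IsIntegralCurveOn η (fun _ => lanfordField a) (Icc 0 τ) :=
    hη.mono Icc_subset_Ici_self
  have hηz : ∀ t ∈ Icc 0 τ, η t 2 ∈ Icc 0 Z := fun t ht =>
    hZ _ (hinv.mem_of_isIntegralCurveOn hη (by rwa [hη0]) ht)
  obtain ⟨M, hM0, hM⟩ := exists_lanford_fundamental_matrix hτ hη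
  obtain ⟨F, hF, hFc⟩ := exists_finset_cover_of_linear_image_add hδ (c := η τ)
    (S := flowImage (lanfordField a) τ (Metric.ball q δ ∩ K)) (M := M τ)
    (P := diagonal ![1, 1, 2] + M τ * (M τ)ᵀ) (by
      rw [add_sub_add_right_eq_sub, ← diagonal_one, diagonal_sub]
      refine PosSemidef.diagonal fun i => ?_
      fin_cases i <;> simp) (by
      rintro _ ⟨γ, hγ, ⟨hγq, hγK⟩, rfl⟩
      have hγz : ∀ t ∈ Icc 0 τ, γ t 2 ∈ Icc 0 Z := fun t ht =>
        hZ _ (hinv.mem_of_isIntegralCurveOn hγ hγK ht)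
      have hu : ‖γ 0 - η 0‖ < δ := by rwa [hη0, ← dist_eq_norm]
      refine ⟨γ 0 - η 0, hu, ?_⟩
      have herr := lanford_linearization_error ha0 hZ0 hγ hη hγz hηz
        (m := fun t => WithLp.toLp 2 (M t *ᵥ (γ 0 - η 0).ofLp)) (by simp [hM0]) (by
          intro t ht i
          have h := HasDerivWithinAt.fun_sum (u := Finset.univ)
            fun k _ => (hM t ht i k).mul_const ((γ 0 - η 0).ofLp k)
          refine h.congr_deriv ?_
          rw [mulVec_mulVec]
          rfl) hτ
      have h0 : lanfordDistSq (γ 0) (η 0) ≤ δ ^ 2 :=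
        (lanfordDistSq_le_norm_sub_sq _ _).trans (pow_le_pow_left₀ (norm_nonneg _) hu.le 2)
      have h1 := norm_sub_sq_le_two_mul_lanfordDistSq (γ τ)
        (η τ + WithLp.toLp 2 (M τ *ᵥ (γ 0 - η 0).ofLp))
      have h2 : lanfordDistSq (γ 0) (η 0) ^ 2 ≤ (δ ^ 2) ^ 2 :=
        pow_le_pow_left₀ (by unfold lanfordDistSq; positivity) h0 2
      rw [← sub_sub] at h1
      refine le_of_sq_le_sq ?_ (by positivity)
      have h3 := mul_le_mul_of_nonneg_right h2 hB0.le
      have h4 := mul_le_mul_of_nonneg_right hδB.le (sq_nonneg δ)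
      nlinarith)
  refine ⟨F, hF, hFc.trans ?_⟩
  have hdet := lanford_det_le ha hZ0 hτ (fun t ht => ⟨(hηz t ht).1, by
    refine (lanford_z_le hη ht).trans ?_
    have h0 := (hηz 0 (left_mem_Icc.2 hτ)).2
    have := mul_le_mul_of_nonneg_right (show η 0 2 - a ≤ Z by linarith)
      (Real.exp_pos (-a * t)).le
    linarith⟩) hM0 hM
  calc 4 ^ 3 * √(diagonal ![1, 1, 2] + M τ * (M τ)ᵀ).det
      ≤ 4 ^ 3 * √(12 * Real.exp (4 * (2 * a - 1) * τ + 4 * Z / a)) := by gcongr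
    _ = 4 ^ 3 * √12 * Real.exp (2 * Z / a + 2 * (2 * a - 1) * τ) := by
        rw [Real.sqrt_mul (by norm_num), ← mul_assoc, Real.sqrt_eq_rpow (Real.exp _),
          ← Real.exp_mul]
        congr 2
        ring
    _ = _ := by
        rw [add_assoc, Real.exp_add (Real.log _), Real.exp_log (by positivity)]

/-! ### Expansion at the equilibrium and the lower bound -/

theorem lanfordField_lanfordO2 (a : ℝ) : lanfordField a (lanfordO2 a) = 0 := by
  ext i
  fin_cases i <;> simp [lanfordField, lanfordO2]
  ring

/-- Near the equilibrium, two orbits whose initial difference is horizontal separate at the rate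
`2 a - 1 - ε`: with `w` their difference, `F = w₀² + w₁² - w₂²` satisfies
`F' ≥ 2 (2 a - 1 - ε) F`. -/
theorem lanford_expansion {a ε T : ℝ} (ha : 2 / 3 ≤ a) (hε0 : 0 < ε) (hε1 : ε ≤ 1 / 10)
    (hT : 0 ≤ T) {γ η : ℝ → EuclideanSpace ℝ (Fin 3)}
    (hγ : IsIntegralCurveOn γ (fun _ => lanfordField a) (Icc 0 T))
    (hη : IsIntegralCurveOn η (fun _ => lanfordField a) (Icc 0 T))
    (hγn : ∀ t ∈ Icc 0 T, ∀ i, |(γ t - lanfordO2 a) i| ≤ ε / 10)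
    (hηn : ∀ t ∈ Icc 0 T, ∀ i, |(η t - lanfordO2 a) i| ≤ ε / 10)
    (hh : γ 0 2 = η 0 2) :
    Real.exp ((2 * a - 1 - ε) * T) * ‖γ 0 - η 0‖ ≤ ‖γ T - η T‖ := by
  have h := le_mul_exp_of_hasDerivWithinAt_le
    (y := fun t => (γ t 2 - η t 2) ^ 2 - (γ t 0 - η t 0) ^ 2 - (γ t 1 - η t 1) ^ 2)
    (g := fun t => 2 * (2 * a - 1 - ε) * t) (g' := fun _ => 2 * (2 * a - 1 - ε))
    (fun t ht => by
      obtain ⟨hx, hy, hz⟩ := hasDerivWithinAt_lanford_coord hγ ht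
      obtain ⟨hx', hy', hz'⟩ := hasDerivWithinAt_lanford_coord hη ht
      exact (((hz.sub hz').pow 2).sub ((hx.sub hx').pow 2)).sub ((hy.sub hy').pow 2))
    (fun t _ => by
      simpa using ((hasDerivAt_id t).const_mul (2 * (2 * a - 1 - ε))).hasDerivWithinAt)
    (fun t ht => by
      have g0 := hγn t ht 0
      have g1 := hγn t ht 1
      have g2 := hγn t ht 2
      have e0 := hηn t ht 0
      have e1 := hηn t ht 1
      have e2 := hηn t ht 2
      simp only [PiLp.sub_apply, lanfordO2, Matrix.cons_val, sub_zero, abs_le] at g0 g1 g2 e0 e1 e2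
      simp only [Pi.sub_apply, Nat.cast_ofNat, Nat.add_one_sub_one, pow_one]
      generalize γ t 0 = x at *
      generalize γ t 1 = y at *
      generalize γ t 2 = z at *
      generalize η t 0 = x' at *
      generalize η t 1 = y' at *
      generalize η t 2 = z' at *
      obtain ⟨X, hX⟩ : ∃ X, X = (x + x') / 2 := ⟨_, rfl⟩
      obtain ⟨Y, hY⟩ : ∃ Y, Y = (y + y') / 2 := ⟨_, rfl⟩
      obtain ⟨Z, hZ⟩ : ∃ Z, Z = (z + z') / 2 := ⟨_, rfl⟩
      obtain ⟨u, hu⟩ : ∃ u, u = x - x' := ⟨_, rfl⟩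
      obtain ⟨v, hv⟩ : ∃ v, v = y - y' := ⟨_, rfl⟩
      obtain ⟨w, hw⟩ : ∃ w, w = z - z' := ⟨_, rfl⟩
      -- A quadratic field has as its increment the Jacobian at the midpoint.
      have main : 0 ≤ 2 * (Z - a + ε) * (u ^ 2 + v ^ 2) + 2 * (a + 2 * Z - 1 - ε) * w ^ 2
          + 6 * w * (X * u + Y * v) := by
        have f1 := mul_nonneg (show 0 ≤ ε / 10 - X by linarith) (sq_nonneg (w - u))
        have f2 := mul_nonneg (show 0 ≤ ε / 10 + X by linarith) (sq_nonneg (w + u))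
        have f3 := mul_nonneg (show 0 ≤ ε / 10 - Y by linarith) (sq_nonneg (w - v))
        have f4 := mul_nonneg (show 0 ≤ ε / 10 + Y by linarith) (sq_nonneg (w + v))
        have f5 := mul_nonneg (show 0 ≤ Z - a + ε - 9 / 10 * ε by linarith)
          (add_nonneg (sq_nonneg u) (sq_nonneg v))
        have f6 := mul_nonneg (show 0 ≤ a + 2 * Z - 1 - ε - 8 / 10 by linarith) (sq_nonneg w)
        have f7 := mul_nonneg hε0.le (add_nonneg (sq_nonneg u) (sq_nonneg v))
        have f8 := mul_nonneg (show 0 ≤ 1 / 10 - ε by linarith) (sq_nonneg w)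
        have f9 := sq_nonneg w
        linarith
      obtain rfl : x = X + u / 2 := by rw [hX, hu]; ring
      obtain rfl : x' = X - u / 2 := by linarith
      obtain rfl : y = Y + v / 2 := by rw [hY, hv]; ring
      obtain rfl : y' = Y - v / 2 := by linarith
      obtain rfl : z = Z + w / 2 := by rw [hZ, hw]; ring
      obtain rfl : z' = Z - w / 2 := by linarith
      linarith) (right_mem_Icc.2 hT)
  refine le_of_sq_le_sq ?_ (norm_nonneg _)
  rw [mul_pow, ← Real.exp_nat_mul, EuclideanSpace.real_norm_sq_eq, EuclideanSpace.real_norm_sq_eq,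
    Fin.sum_univ_three, Fin.sum_univ_three]
  simp only [PiLp.sub_apply, hh, sub_self, mul_zero, sub_zero] at h ⊢
  rw [show ((2 : ℕ) : ℝ) * ((2 * a - 1 - ε) * T) = 2 * (2 * a - 1 - ε) * T by push_cast; ring]
  nlinarith [sq_nonneg (γ T 2 - η T 2)]

/-- The lower bound: near the equilibrium there is an interior point `q` of `K` such that, for all
small `δ`, the image of the `δ`-ball at `q` needs at least `exp (2 (2 a - 1 - ε) τ) / 16` balls. The
point is taken in the interior because `K` may be thin at the equilibrium itself. -/
theorem exists_lanford_separated {a ε τ : ℝ} (ha : 2 / 3 ≤ a) (hε0 : 0 < ε) (hε1 : ε ≤ 1 / 10)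
    (hτ : 0 ≤ τ) {K : Set (EuclideanSpace ℝ (Fin 3))}
    (hK : IsCompact K) (hinv : IsForwardInvariantSet (lanfordField a) K)
    (hcl : K = closure (interior K)) (hO : lanfordO2 a ∈ K) :
    ∃ q ∈ K, ∀ᶠ δ in 𝓝[>] (0 : ℝ), ∃ N : ℕ, Real.exp (2 * (2 * a - 1 - ε) * τ) / 16 ≤ N ∧
      (N : ℕ∞) ≤ ballCoveringNumber δ
        (flowImage (lanfordField a) τ (Metric.ball q δ ∩ K)) := by
  have ha0 : 0 < a := by linarith
  obtain ⟨Z, hZ0, hZ⟩ := exists_lanford_z_mem_Icc ha0 hK hinv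
  -- Orbits of length `τ` that start within `r` of the equilibrium stay within `ε / 10` of it.
  set r : ℝ := ε / 20 * Real.exp (-((a + Z) * τ)) with hr
  have hr0 : 0 < r := by positivity
  have hO' : IsIntegralCurveOn (fun _ => lanfordO2 a) (fun _ => lanfordField a) (Icc 0 τ) :=
    fun t _ => by
      simpa only [lanfordField_lanfordO2] using hasDerivWithinAt_const _ _ _
  have hnear : ∀ γ : ℝ → EuclideanSpace ℝ (Fin 3),
      IsIntegralCurveOn γ (fun _ => lanfordField a) (Icc 0 τ) → γ 0 ∈ K →
      ‖γ 0 - lanfordO2 a‖ ≤ r → ∀ t ∈ Icc 0 τ, ∀ i, |(γ t - lanfordO2 a) i| ≤ ε / 10 := by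
    intro γ hγ h0 hγr t ht i
    refine (PiLp.norm_apply_le (γ t - lanfordO2 a) i).trans
      (le_of_sq_le_sq ?_ (by positivity))
    refine (norm_sub_sq_le_two_mul_lanfordDistSq _ _).trans ?_
    have h1 := lanfordDistSq_le_mul_exp hZ0 hγ hO'
      (fun t ht => hZ _ (hinv.mem_of_isIntegralCurveOn hγ h0 ht)) (fun _ _ => hZ _ hO) ht
    have h2 := (lanfordDistSq_le_norm_sub_sq (γ 0) (lanfordO2 a)).trans
      (pow_le_pow_left₀ (norm_nonneg _) hγr 2)
    have h3 : Real.exp (2 * (a + Z) * t) ≤ Real.exp ((a + Z) * τ) ^ 2 := by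
      rw [← Real.exp_nat_mul]
      refine Real.exp_le_exp.2 ?_
      have := mul_le_mul_of_nonneg_left ht.2 (show 0 ≤ 2 * (a + Z) by positivity)
      push_cast
      linarith
    have h4 : r ^ 2 * Real.exp ((a + Z) * τ) ^ 2 = (ε / 20) ^ 2 := by
      rw [← mul_pow, hr, mul_assoc, ← Real.exp_add, neg_add_cancel, Real.exp_zero, mul_one]
    have h5 := mul_le_mul h2 h3 (Real.exp_pos _).le (sq_nonneg r)
    nlinarith [sq_nonneg ε]
  obtain ⟨q, hqK, hqr⟩ : ∃ q ∈ interior K, dist (lanfordO2 a) q < r / 2 :=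
    Metric.mem_closure_iff.1 (hcl ▸ hO) (r / 2) (by positivity)
  refine ⟨q, interior_subset hqK, ?_⟩
  obtain ⟨ρ, hρ0, hρ⟩ := Metric.isOpen_iff.1 isOpen_interior q hqK
  filter_upwards [Ioo_mem_nhdsGT (lt_min hρ0 (half_pos hr0))] with δ hδ
  obtain ⟨hδ0, hδ1⟩ := hδ
  -- A horizontal `m × m` grid of mesh `κ` fits into the `δ`-ball at `q`, and the flow, which
  -- expands by `l`, carries it to a `2 δ`-separated set.
  set l : ℝ := Real.exp ((2 * a - 1 - ε) * τ) with hl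
  have hl0 : 0 < l := Real.exp_pos _
  set κ : ℝ := 2 * δ / l with hκ
  have hκ0 : 0 < κ := by positivity
  set m : ℕ := ⌊l / 4⌋₊ + 1 with hm
  have hm1 : l / 4 ≤ m := by
    rw [hm]; push_cast; exact (Nat.lt_floor_add_one _).le
  have hκm : ∀ i : ℕ, i ∈ Finset.range m → κ * i ≤ δ / 2 := fun i hi => by
    have h1 : (i : ℝ) ≤ l / 4 :=
      (Nat.cast_le.2 (Nat.lt_succ_iff.1 (Finset.mem_range.1 hi))).trans
        (Nat.floor_le (by positivity))
    calc κ * i ≤ κ * (l / 4) := by gcongr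
      _ = δ / 2 := by rw [hκ]; field_simp; norm_num
  let P : ℕ × ℕ → EuclideanSpace ℝ (Fin 3) := fun ij => q + !₂[κ * ij.1, κ * ij.2, 0]
  have hPq : ∀ ij ∈ Finset.range m ×ˢ Finset.range m, ‖P ij - q‖ < δ := by
    rintro ⟨i, j⟩ hij
    obtain ⟨hi, hj⟩ := Finset.mem_product.1 hij
    refine lt_of_pow_lt_pow_left₀ 2 hδ0.le ?_
    rw [add_sub_cancel_left, EuclideanSpace.real_norm_sq_eq, Fin.sum_univ_three]
    have h1 := pow_le_pow_left₀ (by positivity) (hκm i hi) 2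
    have h2 := pow_le_pow_left₀ (by positivity) (hκm j hj) 2
    simp only [Matrix.cons_val]
    nlinarith [sq_pos_of_pos hδ0]
  have hPK : ∀ ij ∈ Finset.range m ×ˢ Finset.range m, P ij ∈ Metric.ball q δ ∩ K := by
    intro ij hij
    have h1 := hPq ij hij
    rw [← dist_eq_norm] at h1
    exact ⟨h1, interior_subset (hρ (h1.trans (hδ1.trans_le (min_le_left _ _))))⟩
  have hex : ∀ ij, ∃ γ : ℝ → EuclideanSpace ℝ (Fin 3),
      ij ∈ Finset.range m ×ˢ Finset.range m → γ 0 = P ij ∧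
        IsIntegralCurveOn γ (fun _ => lanfordField a) (Icc 0 τ) := fun ij => by
    by_cases hij : ij ∈ Finset.range m ×ˢ Finset.range m
    · obtain ⟨γ, h0, hγ⟩ := hinv.1 _ (hPK ij hij).2
      exact ⟨γ, fun _ => ⟨h0, hγ.mono Icc_subset_Ici_self⟩⟩
    · exact ⟨fun _ => 0, fun h => absurd h hij⟩
  choose γ hγ using hex
  refine ⟨(Finset.range m ×ˢ Finset.range m).card, ?_,
    le_ballCoveringNumber_of_separated _ (fun ij => γ ij τ) (fun ij hij => ?_) ?_⟩
  · rw [Finset.card_product, Finset.card_range]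
    have h1 : Real.exp (2 * (2 * a - 1 - ε) * τ) = l * l := by
      rw [hl, ← Real.exp_add]; ring_nf
    have h2 := mul_le_mul hm1 hm1 (by positivity) (by positivity)
    rw [h1]
    push_cast
    linarith
  · exact ⟨γ ij, (hγ ij hij).2, by rw [(hγ ij hij).1]; exact hPK ij hij, rfl⟩
  · have hn : ∀ ij ∈ Finset.range m ×ˢ Finset.range m, ∀ t ∈ Icc 0 τ, ∀ i,
        |(γ ij t - lanfordO2 a) i| ≤ ε / 10 := fun ij hij => by
      refine hnear _ (hγ ij hij).2 (by rw [(hγ ij hij).1]; exact (hPK ij hij).2) ?_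
      rw [(hγ ij hij).1]
      have h1 := norm_sub_le_norm_sub_add_norm_sub (P ij) q (lanfordO2 a)
      have h2 := hPq ij hij
      rw [dist_comm, dist_eq_norm] at hqr
      have h3 := hδ1.trans_le (min_le_right _ _)
      linarith
    intro ij hij kl hkl hne
    have h1 := lanford_expansion ha hε0 hε1 hτ (hγ ij hij).2 (hγ kl hkl).2 (hn ij hij)
      (hn kl hkl) (by rw [(hγ ij hij).1, (hγ kl hkl).1]; simp [P])
    rw [(hγ ij hij).1, (hγ kl hkl).1] at h1
    have h2 : κ ≤ ‖P ij - P kl‖ := by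
      have hnat : ∀ i k : ℕ, i ≠ k → (1 : ℝ) ≤ |(i : ℝ) - k| := fun i k hik => by
        have : (1 : ℤ) ≤ |(i : ℤ) - k| := Int.one_le_abs (by omega)
        exact_mod_cast this
      have hc : ij.1 ≠ kl.1 ∨ ij.2 ≠ kl.2 := by
        by_contra! hc
        exact hne (Prod.ext hc.1 hc.2)
      rcases hc with hc | hc
      · refine le_trans ?_ (PiLp.norm_apply_le (P ij - P kl) 0)
        simp only [P, PiLp.sub_apply, Matrix.cons_val, add_sub_add_left_eq_sub,
          ← mul_sub, Real.norm_eq_abs, abs_mul, abs_of_pos hκ0]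
        exact le_mul_of_one_le_right hκ0.le (hnat _ _ hc)
      · refine le_trans ?_ (PiLp.norm_apply_le (P ij - P kl) 1)
        simp only [P, PiLp.sub_apply, Matrix.cons_val, add_sub_add_left_eq_sub,
          ← mul_sub, Real.norm_eq_abs, abs_mul, abs_of_pos hκ0]
        exact le_mul_of_one_le_right hκ0.le (hnat _ _ hc)
    rw [dist_eq_norm]
    refine le_trans ?_ h1
    calc 2 * δ = l * κ := by rw [hκ]; field_simp
      _ ≤ _ := by gcongr

/-! ### Restoration entropy -/

theorem extLog2_le {N : ℕ∞} {x : ℝ} (h : (N : ENNReal) ≤ ENNReal.ofReal (Real.exp x)) :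
    extLog2 N ≤ ((x / Real.log 2 : ℝ) : EReal) := by
  rw [extLog2, EReal.coe_div]
  refine EReal.div_le_div_right_of_nonneg (EReal.coe_nonneg.2 (Real.log_nonneg one_le_two)) ?_
  refine (ENNReal.log_le_log h).trans (le_of_eq ?_)
  rw [ENNReal.log_ofReal_of_pos (Real.exp_pos x), Real.log_exp]

theorem le_extLog2 {N : ℕ∞} {x : ℝ} (h : ENNReal.ofReal (Real.exp x) ≤ (N : ENNReal)) :
    ((x / Real.log 2 : ℝ) : EReal) ≤ extLog2 N := by
  rw [extLog2, EReal.coe_div]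
  refine EReal.div_le_div_right_of_nonneg (EReal.coe_nonneg.2 (Real.log_nonneg one_le_two)) ?_
  refine le_trans (le_of_eq ?_) (ENNReal.log_le_log h)
  rw [ENNReal.log_ofReal_of_pos (Real.exp_pos x), Real.log_exp]

theorem mainTheorem4 (a : ℝ) (ha : 2 / 3 ≤ a) (K : Set (EuclideanSpace ℝ (Fin 3)))
    (hK : IsCompact K) (hinv : IsForwardInvariantSet (lanfordField a) K)
    (hcl : K = closure (interior K)) (hO : lanfordO2 a ∈ K) :
    HasRestorationEntropy (lanfordField a) K ((2 * (2 * a - 1) / Real.log 2 : ℝ) : EReal) := by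
  obtain ⟨C, hC⟩ := exists_lanford_cover ha hK hinv
  have hlog : 0 < Real.log 2 := Real.log_pos one_lt_two
  have hupper : ∀ τ : ℝ, 0 ≤ τ → restorationRate (lanfordField a) K τ ≤
      (((C + 2 * (2 * a - 1) * τ) / Real.log 2 : ℝ) : EReal) := fun τ hτ => by
    refine limsup_le_of_le (by isBoundedDefault) ?_
    filter_upwards [hC τ hτ] with δ hδ
    refine iSup₂_le fun q hq => ?_
    obtain ⟨F, hF, hFc⟩ := hδ q hq
    refine extLog2_le ?_
    calc ((ballCoveringNumber δ _ : ℕ∞) : ENNReal) ≤ ((F.card : ℕ∞) : ENNReal) :=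
          ENat.toENNReal_le.2 (ballCoveringNumber_le hF)
      _ = ENNReal.ofReal F.card := by simp
      _ ≤ _ := ENNReal.ofReal_le_ofReal hFc
  have hlower : ∀ τ : ℝ, 0 ≤ τ →
      (((-(Real.log 16 + 1) + 2 * (2 * a - 1) * τ) / Real.log 2 : ℝ) : EReal) ≤
        restorationRate (lanfordField a) K τ := fun τ hτ => by
    -- With this `ε` the loss `2 * ε * τ` in the exponent stays bounded.
    obtain ⟨q, hq, hN⟩ := exists_lanford_separated (ε := 1 / (10 * (1 + τ))) ha (by positivity)
      (by
        refine one_div_le_one_div_of_le (by norm_num) ?_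
        linarith) hτ hK hinv hcl hO
    refine le_limsup_of_frequently_le (Eventually.frequently ?_) (by isBoundedDefault)
    filter_upwards [hN] with δ hδ
    obtain ⟨N, hN1, hN2⟩ := hδ
    refine le_trans (le_extLog2 ?_) (le_iSup₂_of_le q hq le_rfl)
    refine le_trans ?_ (ENat.toENNReal_le.2 hN2)
    rw [ENat.toENNReal_coe, ← ENNReal.ofReal_natCast]
    refine ENNReal.ofReal_le_ofReal (le_trans ?_ hN1)
    rw [le_div_iff₀ (by norm_num)]
    nth_rewrite 2 [← Real.exp_log (show (0 : ℝ) < 16 by norm_num)]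
    rw [← Real.exp_add]
    refine Real.exp_le_exp.2 ?_
    have : 1 / (10 * (1 + τ)) * τ ≤ 1 / 10 := by
      rw [div_mul_eq_mul_div, div_le_div_iff₀ (by positivity) (by norm_num)]
      linarith
    linarith
  have hlim : ∀ c : ℝ, Tendsto (fun τ : ℝ =>
      ((((c + 2 * (2 * a - 1) * τ) / Real.log 2 / τ : ℝ)) : EReal)) atTop
      (𝓝 ((2 * (2 * a - 1) / Real.log 2 : ℝ) : EReal)) := fun c => by
    refine EReal.tendsto_coe.2 ?_
    have h1 : Tendsto (fun τ : ℝ => c / Real.log 2 / τ + 2 * (2 * a - 1) / Real.log 2) atTop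
        (𝓝 (0 + 2 * (2 * a - 1) / Real.log 2)) :=
      (tendsto_const_nhds.div_atTop tendsto_id).add tendsto_const_nhds
    rw [zero_add] at h1
    refine h1.congr' ?_
    filter_upwards [eventually_gt_atTop 0] with τ hτ
    field_simp
  refine tendsto_of_tendsto_of_tendsto_of_le_of_le' (hlim (-(Real.log 16 + 1)))
    (hlim C) ?_ ?_
  · filter_upwards [eventually_gt_atTop 0] with τ hτ
    rw [EReal.coe_div _ τ]
    exact EReal.div_le_div_right_of_nonneg (EReal.coe_nonneg.2 hτ.le) (hlower τ hτ.le)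
  · filter_upwards [eventually_gt_atTop 0] with τ hτ
    rw [EReal.coe_div _ τ]
    exact EReal.div_le_div_right_of_nonneg (EReal.coe_nonneg.2 hτ.le) (hupper τ hτ.le)
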